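/- Let $H$ be a separable infinite-dimensional complex Hilbert space and let $\mathcal U$ be the group of all unitary operators on $H$. Let $\mathcal F\subseteq\mathcal U$ be symmetric, i.e. $A^*\in\mathcal F$ for every $A\in\mathcal F$, and closed in $\mathcal U$ for the strong operator topology (the topology of pointwise convergence on $H$). Let $U_0,U_1,U_2,\dots$ be a sequence in $\mathcal U$ such that $\mathcal U$ is generated as a group by $\mathcal F\cup\{U_0,U_1,U_2,\dots\}$. Then there is a natural number $n$ such that $$\bigl(\mathcal F\cup\{1,U_0,U_0^*,\dots,U_n,U_n^*\}\bigr)^n=\mathcal U,$$ where $E^n$ denotes the set of all products $A_1A_2\cdots A_n$ with $A_1,\dots,A_n\in E$. -/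

import Mathlib

open scoped Pointwise Topology

/-- The group of unitary operators of the complex Hilbert space `H`; its inverse is `star`,
the adjoint. -/
abbrev UnitaryOperators (H : Type*) [NormedAddCommGroup H] [InnerProductSpace ℂ H]
    [CompleteSpace H] : Type _ :=
  unitary (H →L[ℂ] H)

/-- The strong operator topology on the unitary group of `H`: the topology of pointwise convergence
on `H` (with its norm topology). It is not an instance, since `unitary (H →L[ℂ] H)` carries the
operator norm topology by default. -/
@[reducible] def strongOperatorTopology (H : Type*) [NormedAddCommGroup H] [InnerProductSpace ℂ H]
    [CompleteSpace H] : TopologicalSpace (UnitaryOperators H) :=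
  TopologicalSpace.induced (fun (U : UnitaryOperators H) (x : H) => (U : H →L[ℂ] H) x)
    Pi.topologicalSpace

/-- The set `F ∪ {1, U₀, U₀*, …, Uₙ, Uₙ*}`. -/
def adjoinUnitaries {H : Type*} [NormedAddCommGroup H] [InnerProductSpace ℂ H]
    [CompleteSpace H] (F : Set (UnitaryOperators H)) (U : ℕ → UnitaryOperators H) (n : ℕ) :
    Set (UnitaryOperators H) :=
  F ∪ ({1} ∪ {A | ∃ i : ℕ, i ≤ n ∧ (A = U i ∨ A = star (U i))})

/-!
The proof combines a Baire category argument with a geometric factorization of unitary operators.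

With the strong operator topology the unitary group is Polish: recording the values of `A` and of
`A*` on a dense sequence is an embedding with closed range (`polishSpace_unitary`). The sets
`E n = F ∪ {1, U₀, U₀*, …, Uₙ, Uₙ*}` are closed, so their powers `E n ^ n` are analytic, and as the
`E n` increase and generate, these powers cover the group. By Baire's theorem some `E n ^ n` is not
meagre. Analytic sets have the Baire property
(`MeasureTheory.AnalyticSet.exists_isOpen_isMeagre_diff`), hence by Pettis' argument the product of
`E n ^ n` with its inverse, which lies in `E (n + n) ^ (n + n)`, is a neighbourhood of `1`.

A neighbourhood of `1` contains the pointwise stabilizer `K` of a finite family `x` of vectors.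
As the space is infinite-dimensional, some unitary operator `g` moves `x` to a family orthogonal to
it, and then every unitary operator is in `K g K g⁻¹ K` (`exists_stabilizer_factorization`). Since
`g` and `g⁻¹` are themselves in some `E m ^ m`, the lengths add up to a uniform bound.

The unitary operators needed come from Gram matrices: two finite families with the same Gram matrix
are related by a unitary operator that fixes the orthogonal complement of both
(`exists_unitary_of_inner_eq`).
-/

/-! ### Analytic sets have the Baire property -/

/-- The frontier of an open set is meagre. -/
theorem IsOpen.isMeagre_frontier {X : Type*} [TopologicalSpace X] {s : Set X} (hs : IsOpen s) :
    IsMeagre (frontier s) := by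
  refine IsNowhereDense.isMeagre ?_
  rw [isClosed_frontier.isNowhereDense_iff, ← frontier_compl, interior_frontier hs.isClosed_compl]

/-- Every set `A` has an open *category envelope* `I`: it contains `A` up to a meagre set, and `A`
is non-meagre in every nonempty open subset of `I`. -/
theorem exists_isOpen_categoryEnvelope {X : Type*} [TopologicalSpace X]
    [SecondCountableTopology X] (A : Set X) :
    ∃ I : Set X, IsOpen I ∧ IsMeagre (A \ I) ∧
      ∀ O : Set X, IsOpen O → O ⊆ I → IsMeagre (A ∩ O) → O = ∅ := by
  have hB := TopologicalSpace.isBasis_countableBasis X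
  -- `M` is the largest open set in which `A` is meagre.
  set S : Set (Set X) := {B ∈ TopologicalSpace.countableBasis X | IsMeagre (A ∩ B)} with hS
  set M : Set X := ⋃ B ∈ S, B with hM
  have hMo : IsOpen M := isOpen_biUnion fun B hBS => hB.isOpen hBS.1
  have hAM : IsMeagre (A ∩ M) := by
    rw [hM, Set.inter_iUnion₂]
    exact isMeagre_biUnion ((TopologicalSpace.countable_countableBasis X).mono fun B h => h.1)
      fun B h => h.2
  refine ⟨(closure M)ᶜ, isClosed_closure.isOpen_compl, ?_, fun O hO hOI hAO => ?_⟩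
  · refine (hAM.union hMo.isMeagre_frontier).mono ?_
    rintro x ⟨hxA, hx⟩
    by_cases hxM : x ∈ M
    · exact Or.inl ⟨hxA, hxM⟩
    · exact Or.inr ⟨not_not.mp hx, by rwa [hMo.interior_eq]⟩
  · refine Set.eq_empty_of_forall_notMem fun x hx => ?_
    obtain ⟨B, hBb, hxB, hBO⟩ := hB.exists_subset_of_mem_open hx hO
    exact hOI hx (subset_closure (Set.mem_biUnion
      (show B ∈ S from ⟨hBb, hAO.mono (Set.inter_subset_inter_right A hBO)⟩) hxB))

/-- A point in the closure of the images of all cylinders around `a` is the image of `a`. -/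
theorem eq_of_forall_mem_closure_image_cylinder {X : Type*} [TopologicalSpace X] [T2Space X]
    {f : (ℕ → ℕ) → X} (hf : Continuous f) {a : ℕ → ℕ} {x : X}
    (h : ∀ k, x ∈ closure (f '' PiNat.cylinder a k)) : x = f a := by
  by_contra hne
  obtain ⟨u, v, hu, hv, hxu, hav, huv⟩ := t2_separation hne
  obtain ⟨_, ⟨b, k, rfl⟩, hab, hsub⟩ :=
    (PiNat.isTopologicalBasis_cylinders (fun _ => ℕ)).exists_subset_of_mem_open
      (show a ∈ f ⁻¹' v from hav) (hv.preimage hf)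
  rw [← PiNat.mem_cylinder_iff_eq.mp hab] at hsub
  obtain ⟨_, hzu, z, hz, rfl⟩ := mem_closure_iff.mp (h k) u hu hxu
  exact Set.disjoint_left.mp huv hzu (hsub hz)

/-- **Analytic sets have the Baire property** (Lusin–Sierpiński): they coincide with an open set up
to meagre sets. For `A = f(ℕ^ℕ)`, take an open category envelope of the image of every cylinder.
The envelope of a cylinder is covered, up to a meagre set, by those of its children, so that
outside a meagre set a point of the envelope of `A` determines an infinite branch `a` of nested
cylinders, and it must be `f a`. -/
theorem MeasureTheory.AnalyticSet.exists_isOpen_isMeagre_diff {X : Type*} [TopologicalSpace X]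
    [SecondCountableTopology X] [T2Space X] {A : Set X} (hA : MeasureTheory.AnalyticSet A) :
    ∃ I : Set X, IsOpen I ∧ IsMeagre (A \ I) ∧ IsMeagre (I \ A) := by
  rw [MeasureTheory.AnalyticSet] at hA
  obtain rfl | ⟨f, hf, rfl⟩ := hA
  · exact ⟨∅, isOpen_empty, by simpa using IsMeagre.empty, by simpa using IsMeagre.empty⟩
  -- The cylinders of `ℕ^ℕ`, indexed by finite lists in reverse order.
  let N : List ℕ → Set (ℕ → ℕ) := fun s => {a | PiNat.res a s.length = s}
  choose I hIo hIA hI using fun s => exists_isOpen_categoryEnvelope (f '' N s)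
  have hN : ∀ s a, a ∈ N s → a ∈ N (a s.length :: s) := fun s a ha => by
    simpa [N, PiNat.res_succ] using ha
  have hcl : ∀ s, I s ⊆ closure (f '' N s) := by
    intro s
    rw [← Set.sdiff_eq_empty]
    refine hI s _ ((hIo s).sdiff isClosed_closure) Set.sdiff_subset ?_
    refine IsMeagre.empty.mono ?_
    rintro x ⟨hx, -, hx'⟩
    exact hx' (subset_closure hx)
  have hstep : ∀ s, IsMeagre (I s \ ⋃ n, I (n :: s)) := by
    intro s
    set P := ⋃ n, I (n :: s) with hP
    have hPo : IsOpen P := isOpen_iUnion fun n => hIo _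
    have hsub : I s \ closure P = ∅ := by
      refine hI s _ ((hIo s).sdiff isClosed_closure) Set.sdiff_subset ?_
      refine (isMeagre_iUnion fun n => hIA (n :: s)).mono ?_
      rintro _ ⟨⟨a, ha, rfl⟩, -, hx⟩
      refine Set.mem_iUnion.mpr ⟨a s.length, ⟨a, hN s a ha, rfl⟩, fun h => hx ?_⟩
      exact subset_closure (Set.mem_iUnion.mpr ⟨_, h⟩)
    refine hPo.isMeagre_frontier.mono ?_
    rintro x ⟨hx, hxP⟩
    exact ⟨Set.sdiff_eq_empty.mp hsub hx, by rwa [hPo.interior_eq]⟩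
  have hroot : f '' N [] = Set.range f := by simp [N]
  refine ⟨I [], hIo _, hroot ▸ hIA [], (isMeagre_iUnion hstep).mono ?_⟩
  rintro x ⟨hx, hxA⟩
  by_contra hcon
  have hnext : ∀ s, x ∈ I s → ∃ n, x ∈ I (n :: s) := by
    intro s hs
    by_contra h
    exact hcon (Set.mem_iUnion.mpr ⟨s, hs, fun h' => h (Set.mem_iUnion.mp h')⟩)
  choose! b hb using hnext
  let l : ℕ → List ℕ := fun k => Nat.rec [] (fun _ s => b s :: s) k
  have hl : ∀ k, l (k + 1) = b (l k) :: l k := fun k => rfl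
  have hlen : ∀ k, (l k).length = k := fun k => by
    induction k with
    | zero => rfl
    | succ k ih => rw [hl, List.length_cons, ih]
  have hxl : ∀ k, x ∈ I (l k) := fun k => by
    induction k with
    | zero => exact hx
    | succ k ih => exact hb _ ih
  have hres : ∀ k, PiNat.res (fun i => b (l i)) k = l k := fun k => by
    induction k with
    | zero => rfl
    | succ k ih => rw [PiNat.res_succ, ih, hl]
  refine hxA ⟨fun i => b (l i), (eq_of_forall_mem_closure_image_cylinder hf fun k => ?_).symm⟩
  have hcyl : PiNat.cylinder (fun i => b (l i)) k = N (l k) := by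
    rw [PiNat.cylinder_eq_res, hres, ← hlen k]
    simp [N, hlen]
  rw [hcyl]
  exact hcl _ (hxl k)

/-! ### Polish groups covered by powers of analytic sets -/

/-- **Pettis' theorem** for analytic sets. -/
theorem MeasureTheory.AnalyticSet.mul_inv_mem_nhds_one {G : Type*} [Group G] [TopologicalSpace G]
    [IsTopologicalGroup G] [SecondCountableTopology G] [T2Space G] [BaireSpace G] {A : Set G}
    (hA : MeasureTheory.AnalyticSet A) (hne : ¬ IsMeagre A) : A * A⁻¹ ∈ 𝓝 (1 : G) := by
  obtain ⟨I, hIo, hAI, hIA⟩ := hA.exists_isOpen_isMeagre_diff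
  obtain ⟨x, hx⟩ : I.Nonempty := by
    rw [Set.nonempty_iff_ne_empty]
    rintro rfl
    exact hne (by simpa using hAI)
  have hnear : ∀ᶠ g in 𝓝 (1 : G), g⁻¹ * x ∈ I :=
    (show Continuous fun g : G => g⁻¹ * x by fun_prop).continuousAt.eventually_mem
      (hIo.mem_nhds (by simpa using hx))
  filter_upwards [hnear] with g hg
  -- `I ∩ g I` is open and nonempty, hence it meets `A ∩ g A`, which is comeagre in it.
  have hcont : Continuous fun y : G => g⁻¹ * y := by fun_prop
  have hmap : IsOpenMap fun y : G => g⁻¹ * y := isOpenMap_mul_left g⁻¹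
  have hopen : IsOpen (I ∩ (fun y => g⁻¹ * y) ⁻¹' I) := hIo.inter (hIo.preimage hcont)
  have hmeagre := hIA.union (hIA.preimage_of_isOpenMap hcont hmap)
  obtain ⟨y, ⟨hyI, hyg⟩, hy⟩ : ((I ∩ (fun y => g⁻¹ * y) ⁻¹' I) \
      ((I \ A) ∪ (fun y => g⁻¹ * y) ⁻¹' (I \ A))).Nonempty := by
    rw [Set.sdiff_nonempty]
    exact fun hsub => not_isMeagre_of_isOpen hopen ⟨x, hx, hg⟩ (hmeagre.mono hsub)
  have hyA : y ∈ A := by_contra fun h => hy (Or.inl ⟨hyI, h⟩)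
  have hyA' : g⁻¹ * y ∈ A := by_contra fun h => hy (Or.inr ⟨hyg, h⟩)
  exact ⟨y, hyA, (g⁻¹ * y)⁻¹, Set.inv_mem_inv.mpr hyA', by simp⟩

theorem MeasureTheory.AnalyticSet.mul {G : Type*} [Mul G] [TopologicalSpace G] [ContinuousMul G]
    {A B : Set G} (hA : MeasureTheory.AnalyticSet A) (hB : MeasureTheory.AnalyticSet B) :
    MeasureTheory.AnalyticSet (A * B) := by
  obtain ⟨β, _, _, f, hf, rfl⟩ := MeasureTheory.analyticSet_iff_exists_polishSpace_range.mp hA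
  obtain ⟨γ, _, _, g, hg, rfl⟩ := MeasureTheory.analyticSet_iff_exists_polishSpace_range.mp hB
  have : Set.range f * Set.range g = Set.range fun p : β × γ => f p.1 * g p.2 := by
    ext z
    simp [Set.mem_mul]
  rw [this]
  exact MeasureTheory.analyticSet_range_of_polishSpace (by fun_prop)

theorem MeasureTheory.AnalyticSet.pow {G : Type*} [Monoid G] [TopologicalSpace G]
    [ContinuousMul G] [PolishSpace G] {A : Set G} (hA : MeasureTheory.AnalyticSet A) (n : ℕ) :
    MeasureTheory.AnalyticSet (A ^ n) := by
  induction n with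
  | zero => rw [pow_zero, ← Set.singleton_one]; exact isClosed_singleton.analyticSet
  | succ n ih => rw [pow_succ]; exact ih.mul hA

/-- If an increasing sequence of symmetric sets containing `1` generates a group, then every
element is a product of `n` elements of the `n`-th set, for some `n`. -/
theorem exists_mem_pow_of_closure_iUnion_eq_top {G : Type*} [Group G] {E : ℕ → Set G}
    (hmono : Monotone E) (hone : ∀ n, 1 ∈ E n) (hinv : ∀ n, (E n)⁻¹ = E n)
    (hgen : Subgroup.closure (⋃ n, E n) = ⊤) (g : G) : ∃ n, g ∈ E n ^ n := by
  have hg : g ∈ Subgroup.closure (⋃ n, E n) := hgen ▸ Subgroup.mem_top g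
  induction hg using Subgroup.closure_induction with
  | mem x hx =>
    obtain ⟨n, hn⟩ := Set.mem_iUnion.mp hx
    refine ⟨n + 1, Set.pow_subset_pow_right (hone _) (Nat.le_add_left 1 n) ?_⟩
    simpa using hmono n.le_succ hn
  | one => exact ⟨0, by simp⟩
  | mul x y _ _ hx hy =>
    obtain ⟨m, hm⟩ := hx
    obtain ⟨n, hn⟩ := hy
    refine ⟨m + n, ?_⟩
    rw [pow_add]
    exact Set.mul_mem_mul (Set.pow_subset_pow_left (hmono (Nat.le_add_right m n)) hm)
      (Set.pow_subset_pow_left (hmono (Nat.le_add_left n m)) hn)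
  | inv x _ hx =>
    obtain ⟨n, hn⟩ := hx
    refine ⟨n, ?_⟩
    rw [← hinv n, inv_pow]
    exact Set.inv_mem_inv.mpr hn

/-- In a Polish group generated by an increasing sequence of closed symmetric sets containing `1`,
some power `E n ^ n` is a neighbourhood of `1`. -/
theorem exists_pow_mem_nhds_one {G : Type*} [Group G] [TopologicalSpace G] [IsTopologicalGroup G]
    [PolishSpace G] {E : ℕ → Set G} (hmono : Monotone E) (hone : ∀ n, 1 ∈ E n)
    (hinv : ∀ n, (E n)⁻¹ = E n) (hclosed : ∀ n, IsClosed (E n))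
    (hgen : Subgroup.closure (⋃ n, E n) = ⊤) : ∃ n, E n ^ n ∈ 𝓝 (1 : G) := by
  obtain ⟨n, hn⟩ : ∃ n, ¬ IsMeagre (E n ^ n) := by
    by_contra! h
    refine not_isMeagre_of_isOpen (isOpen_univ (X := G)) Set.univ_nonempty
      ((isMeagre_iUnion h).mono fun g _ => ?_)
    exact Set.mem_iUnion.mpr (exists_mem_pow_of_closure_iUnion_eq_top hmono hone hinv hgen g)
  refine ⟨n + n, Filter.mem_of_superset
    (((hclosed n).analyticSet.pow n).mul_inv_mem_nhds_one hn) ?_⟩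
  rw [← inv_pow, hinv, ← pow_add]
  exact Set.pow_subset_pow_left (hmono (Nat.le_add_right n n))

/-! ### Families with equal Gram matrices -/

section Gram

variable {ι V H : Type*} [NormedAddCommGroup V] [InnerProductSpace ℂ V]
  [NormedAddCommGroup H] [InnerProductSpace ℂ H]

theorem norm_linearCombination_eq_of_inner_eq {x : ι → V} {y : ι → H}
    (h : ∀ i j, inner ℂ (x i) (x j) = inner ℂ (y i) (y j)) (c : ι →₀ ℂ) :
    ‖Finsupp.linearCombination ℂ x c‖ = ‖Finsupp.linearCombination ℂ y c‖ := by
  -- Both squared norms expand to the same double sum of Gram matrix entries.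
  rw [← sq_eq_sq₀ (norm_nonneg _) (norm_nonneg _), @norm_sq_eq_re_inner ℂ, @norm_sq_eq_re_inner ℂ]
  simp only [Finsupp.linearCombination_apply, Finsupp.sum, sum_inner, inner_sum, inner_smul_left,
    inner_smul_right, h]

/-- A family spanning a dense subspace can be mapped isometrically to any family in a Hilbert space
with the same Gram matrix. -/
theorem exists_linearIsometry_of_inner_eq [CompleteSpace H] {x : ι → V} {y : ι → H}
    (hx : Dense (Submodule.span ℂ (Set.range x) : Set V))
    (h : ∀ i j, inner ℂ (x i) (x j) = inner ℂ (y i) (y j)) :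
    ∃ L : V →ₗᵢ[ℂ] H, ∀ i, L (x i) = y i := by
  have hd : DenseRange (Finsupp.linearCombination ℂ x) := by
    rw [← Finsupp.range_linearCombination] at hx
    exact hx
  have hle : ∀ c, ‖Finsupp.linearCombination ℂ y c‖ ≤ 1 * ‖Finsupp.linearCombination ℂ x c‖ :=
    fun c => by rw [one_mul, norm_linearCombination_eq_of_inner_eq h]
  have heq := LinearMap.extendOfNorm_eq hd ⟨1, hle⟩
  refine ⟨⟨((Finsupp.linearCombination ℂ y).extendOfNorm
    (Finsupp.linearCombination ℂ x) : V →L[ℂ] H), fun v => ?_⟩, fun i => ?_⟩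
  · refine hd.induction_on v (isClosed_eq (by fun_prop) (by fun_prop)) fun c => ?_
    change ‖LinearMap.extendOfNorm _ _ _‖ = _
    rw [heq, norm_linearCombination_eq_of_inner_eq h]
  · simpa using heq (Finsupp.single i 1)

/-- In an infinite-dimensional space, a finite family has an isometric copy orthogonal to any given
finite set. -/
theorem exists_inner_eq_orthogonal [Finite ι] (hdim : ¬ FiniteDimensional ℂ H) (x : ι → H)
    {s : Set H} (hs : s.Finite) :
    ∃ z : ι → H, (∀ i j, inner ℂ (z i) (z j) = inner ℂ (x i) (x j)) ∧
      ∀ i, ∀ v ∈ s, inner ℂ v (z i) = 0 := by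
  let S := Submodule.span ℂ s
  have : FiniteDimensional ℂ S := FiniteDimensional.span_of_finite ℂ hs
  have hinf : ¬ FiniteDimensional ℂ Sᗮ := by
    intro _
    refine hdim (Module.finite_def.mpr ?_)
    rw [← Submodule.sup_orthogonal_of_hasOrthogonalProjection (K := S)]
    exact Submodule.FG.sup (Module.Finite.iff_fg.mp inferInstance)
      (Module.Finite.iff_fg.mp inferInstance)
  let V := Submodule.span ℂ (Set.range x)
  have : FiniteDimensional ℂ V := FiniteDimensional.span_of_finite ℂ (Set.finite_range x)
  obtain ⟨b, hb, hbi⟩ := exists_finset_linearIndependent_of_le_rank (R := ℂ) (M := Sᗮ)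
    (n := Module.finrank ℂ V) ((Cardinal.natCast_lt_aleph0.le).trans
      (not_lt.mp fun h => hinf (Module.rank_lt_aleph0_iff.mp h)))
  let T := Submodule.span ℂ (b : Set Sᗮ)
  have hT : Module.finrank ℂ V = Module.finrank ℂ T := by
    rw [← hb, finrank_span_finset_eq_card hbi]
  have : FiniteDimensional ℂ T := FiniteDimensional.span_finset ℂ b
  let e : V ≃ₗᵢ[ℂ] T := (stdOrthonormalBasis ℂ V).equiv (stdOrthonormalBasis ℂ T) (finCongr hT)
  refine ⟨fun i => ((e ⟨x i, Submodule.subset_span ⟨i, rfl⟩⟩ : T) : Sᗮ), fun i j => ?_,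
    fun i v hv => ?_⟩
  · rw [← Submodule.coe_inner, ← Submodule.coe_inner, LinearIsometryEquiv.inner_map_map,
      Submodule.coe_inner]
  · exact (Submodule.mem_orthogonal _ _).mp (Subtype.coe_prop _) v (Submodule.subset_span hv)

end Gram

section Extension

variable {ι H : Type*} [NormedAddCommGroup H] [InnerProductSpace ℂ H] [CompleteSpace H]

/-- A unitary operator of a finite-dimensional subspace, extended by the identity on the orthogonal
complement. -/
theorem exists_unitary_extending (T : Submodule ℂ H) [FiniteDimensional ℂ T] (e : T ≃ₗᵢ[ℂ] T) :
    ∃ A : UnitaryOperators H, (∀ t : T, (A : H →L[ℂ] H) t = e t) ∧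
      ∀ z ∈ Tᗮ, (A : H →L[ℂ] H) z = z := by
  let D := T.orthogonalDecomposition
  let B : H ≃ₗᵢ[ℂ] H :=
    (D.trans (LinearIsometryEquiv.withLpProdCongr 2 e (.refl ℂ Tᗮ))).trans D.symm
  refine ⟨Unitary.linearIsometryEquiv.symm B, fun t => ?_, fun z hz => ?_⟩
  · change D.symm _ = _
    rw [LinearIsometryEquiv.symm_apply_eq]
    simp [D, Submodule.orthogonalProjectionOnto_orthogonal_apply_eq_zero]
  · change D.symm _ = _
    rw [LinearIsometryEquiv.symm_apply_eq]
    simp [D, Submodule.orthogonalProjectionOnto_eq_zero_iff.mpr hz]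

/-- Finite families with equal Gram matrices are related by a unitary operator that fixes every
vector orthogonal to both families. -/
theorem exists_unitary_of_inner_eq [Finite ι] {x y : ι → H}
    (h : ∀ i j, inner ℂ (x i) (x j) = inner ℂ (y i) (y j)) :
    ∃ A : UnitaryOperators H, (∀ i, (A : H →L[ℂ] H) (x i) = y i) ∧
      ∀ z, (∀ i, inner ℂ (x i) z = 0) → (∀ i, inner ℂ (y i) z = 0) → (A : H →L[ℂ] H) z = z := by
  let T : Submodule ℂ H := Submodule.span ℂ (Set.range x ∪ Set.range y)
  have : FiniteDimensional ℂ T :=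
    FiniteDimensional.span_of_finite ℂ ((Set.finite_range x).union (Set.finite_range y))
  let x' : ι → T := fun i => ⟨x i, Submodule.subset_span (Or.inl ⟨i, rfl⟩)⟩
  let y' : ι → T := fun i => ⟨y i, Submodule.subset_span (Or.inr ⟨i, rfl⟩)⟩
  let S : Submodule ℂ T := Submodule.span ℂ (Set.range x')
  let x'' : ι → S := fun i => ⟨x' i, Submodule.subset_span ⟨i, rfl⟩⟩
  have hspan : Submodule.span ℂ (Set.range x'') = ⊤ := by
    have : Set.range x'' = Subtype.val ⁻¹' Set.range x' := by
      ext ⟨s, hs⟩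
      simp [x'']
    rw [this]
    exact Submodule.span_span_coe_preimage
  obtain ⟨L, hL⟩ : ∃ L : S →ₗᵢ[ℂ] T, ∀ i, L (x'' i) = y' i :=
    exists_linearIsometry_of_inner_eq (x := x'') (y := y') (by rw [hspan]; exact dense_univ) h
  obtain ⟨A, hA, hA'⟩ := exists_unitary_extending T (L.extend.toLinearIsometryEquiv rfl)
  refine ⟨A, fun i => ?_, fun z hx hy => hA' z ?_⟩
  · have := hA (x' i)
    rw [LinearIsometry.toLinearIsometryEquiv_apply, L.extend_apply (x'' i), hL] at this
    exact this
  · rw [Submodule.mem_orthogonal]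
    intro u hu
    induction hu using Submodule.span_induction with
    | mem u hu =>
      obtain ⟨i, rfl⟩ | ⟨i, rfl⟩ := hu
      exacts [hx i, hy i]
    | zero => simp
    | add u v _ _ hu hv => rw [inner_add_left, hu, hv, add_zero]
    | smul c u _ hu => rw [inner_smul_left, hu, mul_zero]

/-! ### Products of pointwise stabilizers -/

/-- If `K` is the pointwise stabilizer of a finite family `x` and the unitary operator `g` moves `x`
to a family orthogonal to it, then every unitary operator lies in `K g K g⁻¹ K`.

Indeed, given `u`, some `k ∈ K` moves `g x` to a family orthogonal to both `x` and `u x`. Then a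
unitary operator `w` that moves `u x` to `x` can be chosen in the stabilizer
`(k g) K (k g)⁻¹` of `k g x`, and `w u` is in `K`. -/
theorem exists_stabilizer_factorization [Finite ι] (hdim : ¬ FiniteDimensional ℂ H) (x : ι → H)
    {g : UnitaryOperators H} (hg : ∀ i j, inner ℂ (x i) ((g : H →L[ℂ] H) (x j)) = 0)
    {K : Set (UnitaryOperators H)}
    (hK : ∀ A : UnitaryOperators H, (∀ i, (A : H →L[ℂ] H) (x i) = x i) → A ∈ K)
    (u : UnitaryOperators H) : u ∈ K * {g} * K * {g⁻¹} * K := by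
  have hg' : ∀ i j, inner ℂ ((g : H →L[ℂ] H) (x i)) (x j) = 0 := fun i j => by
    rw [← inner_conj_symm, hg, map_zero]
  have hinv : ∀ (A : UnitaryOperators H) {v w : H}, (A : H →L[ℂ] H) v = w →
      ((A⁻¹ : UnitaryOperators H) : H →L[ℂ] H) w = v := by
    rintro A v _ rfl
    exact (Unitary.linearIsometryEquiv A).symm_apply_apply v
  obtain ⟨z, hz, hz0⟩ := exists_inner_eq_orthogonal hdim x
    ((Set.finite_range x).union (Set.finite_range fun i => (u : H →L[ℂ] H) (x i)))
  have hzx : ∀ i j, inner ℂ (x i) (z j) = 0 := fun i j => hz0 j _ (Or.inl ⟨i, rfl⟩)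
  have hzx' : ∀ i j, inner ℂ (z i) (x j) = 0 := fun i j => by
    rw [← inner_conj_symm, hzx, map_zero]
  have hzu : ∀ i j, inner ℂ ((u : H →L[ℂ] H) (x i)) (z j) = 0 :=
    fun i j => hz0 j _ (Or.inr ⟨i, rfl⟩)
  obtain ⟨k, hk, -⟩ := exists_unitary_of_inner_eq
    (x := Sum.elim x fun i => (g : H →L[ℂ] H) (x i)) (y := Sum.elim x z) (by
      rintro (i | i) (j | j) <;> simp [hg, hg', hzx, hzx', hz, Unitary.inner_map_map])
  have hkx : ∀ i, (k : H →L[ℂ] H) (x i) = x i := fun i => hk (Sum.inl i)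
  have hkz : ∀ i, (k : H →L[ℂ] H) ((g : H →L[ℂ] H) (x i)) = z i := fun i => hk (Sum.inr i)
  obtain ⟨w, hwu, hwz⟩ := exists_unitary_of_inner_eq
    (x := fun i => (u : H →L[ℂ] H) (x i)) (y := x) (fun i j => Unitary.inner_map_map u _ _)
  have hwz' : ∀ i, (w : H →L[ℂ] H) (z i) = z i :=
    fun i => hwz _ (fun j => hzu j i) fun j => hzx j i
  have hmid : g⁻¹ * k⁻¹ * w⁻¹ * k * g ∈ K := hK _ fun i => by
    change ((g⁻¹ : UnitaryOperators H) : H →L[ℂ] H) (((k⁻¹ : UnitaryOperators H) : H →L[ℂ] H)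
      (((w⁻¹ : UnitaryOperators H) : H →L[ℂ] H) ((k : H →L[ℂ] H) ((g : H →L[ℂ] H) (x i))))) = x i
    rw [hkz, hinv w (hwz' i), hinv k (hkz i), hinv g rfl]
  have hright : k⁻¹ * (w * u) ∈ K := hK _ fun i => by
    change ((k⁻¹ : UnitaryOperators H) : H →L[ℂ] H) ((w : H →L[ℂ] H) ((u : H →L[ℂ] H) (x i))) = x i
    rw [hwu, hinv k (hkx i)]
  have hu : u = k * g * (g⁻¹ * k⁻¹ * w⁻¹ * k * g) * g⁻¹ * (k⁻¹ * (w * u)) := by group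
  rw [hu]
  exact Set.mul_mem_mul (Set.mul_mem_mul (Set.mul_mem_mul (Set.mul_mem_mul (hK k hkx) rfl) hmid)
    rfl) hright

end Extension

/-! ### The unitary group is Polish in the strong operator topology -/

/-- For isometries, pointwise convergence on a dense sequence is pointwise convergence: evaluation
at any point is a uniform limit of evaluations at members of the sequence. -/
theorem induced_eval_dense_le_induced_eval {X E : Type*} [PseudoMetricSpace E] {d : ℕ → E}
    (hd : DenseRange d) {f : X → E → E} (hf : ∀ a, Isometry (f a)) :
    TopologicalSpace.induced (fun a n => f a (d n)) Pi.topologicalSpace ≤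
      TopologicalSpace.induced f Pi.topologicalSpace := by
  let _ : TopologicalSpace X := TopologicalSpace.induced (fun a n => f a (d n)) Pi.topologicalSpace
  refine continuous_iff_le_induced.mp (continuous_pi fun x => ?_)
  refine continuous_of_uniform_approx_of_continuous fun u hu => ?_
  obtain ⟨ε, hε, hεu⟩ := Metric.mem_uniformity_dist.mp hu
  obtain ⟨n, hn⟩ := hd.exists_dist_lt x hε
  exact ⟨fun a => f a (d n),
    continuous_pi_iff.mp (continuous_induced_dom (f := fun a n => f a (d n))) n,
    fun a => hεu (by rwa [(hf a).dist_eq])⟩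

section StrongOperatorTopology

variable {H : Type*} [NormedAddCommGroup H] [InnerProductSpace ℂ H] [CompleteSpace H]

attribute [local instance] strongOperatorTopology

theorem continuous_unitary_apply (x : H) :
    Continuous fun A : UnitaryOperators H => (A : H →L[ℂ] H) x :=
  (continuous_apply x).comp continuous_induced_dom

theorem continuous_unitary_iff {X : Type*} [TopologicalSpace X] {f : X → UnitaryOperators H} :
    Continuous f ↔ ∀ x, Continuous fun a => (f a : H →L[ℂ] H) x := by
  rw [continuous_induced_rng, continuous_pi_iff]
  rfl

/-- Reduces convergence of adjoints at `x` to convergence of the operators themselves at the fixed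
vector `B* x`. -/
theorem norm_star_apply_sub (A B : UnitaryOperators H) (x : H) :
    ‖((star A : UnitaryOperators H) : H →L[ℂ] H) x - ((star B : UnitaryOperators H) : H →L[ℂ] H) x‖
      = ‖x - (A : H →L[ℂ] H) (((star B : UnitaryOperators H) : H →L[ℂ] H) x)‖ := by
  rw [← Unitary.norm_map A, map_sub]
  congr 2
  exact (Unitary.linearIsometryEquiv A).apply_symm_apply x

theorem isTopologicalGroup_unitary : IsTopologicalGroup (UnitaryOperators H) where
  continuous_mul := by
    rw [continuous_unitary_iff]
    intro x
    rw [continuous_iff_continuousAt]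
    rintro ⟨A, B⟩
    -- `A' B' x - A B x = A' (B' x - B x) + (A' - A) B x`, where `A'` is isometric.
    have hB : Filter.Tendsto (fun p : UnitaryOperators H × UnitaryOperators H =>
        ‖(p.2 : H →L[ℂ] H) x - (B : H →L[ℂ] H) x‖) (𝓝 (A, B)) (𝓝 0) := by
      have := (((continuous_unitary_apply x).comp continuous_snd).sub
        (continuous_const (y := (B : H →L[ℂ] H) x))).norm.tendsto (A, B)
      simpa using this
    have hA : Filter.Tendsto (fun p : UnitaryOperators H × UnitaryOperators H =>
        ‖(p.1 : H →L[ℂ] H) ((B : H →L[ℂ] H) x) - (A : H →L[ℂ] H) ((B : H →L[ℂ] H) x)‖)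
        (𝓝 (A, B)) (𝓝 0) := by
      have := (((continuous_unitary_apply ((B : H →L[ℂ] H) x)).comp continuous_fst).sub
        (continuous_const (y := (A : H →L[ℂ] H) ((B : H →L[ℂ] H) x)))).norm.tendsto (A, B)
      simpa using this
    refine tendsto_iff_norm_sub_tendsto_zero.mpr (squeeze_zero (fun _ => norm_nonneg _)
      (fun p => ?_) (by simpa using hB.add hA))
    rw [← Unitary.norm_map p.1 ((p.2 : H →L[ℂ] H) x - (B : H →L[ℂ] H) x), map_sub]
    exact norm_sub_le_norm_sub_add_norm_sub _ _ _
  continuous_inv := by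
    rw [continuous_unitary_iff]
    intro x
    rw [continuous_iff_continuousAt]
    intro B
    refine tendsto_iff_norm_sub_tendsto_zero.mpr ?_
    have := ((continuous_const (y := x)).sub (continuous_unitary_apply
      (((star B : UnitaryOperators H) : H →L[ℂ] H) x))).norm.tendsto B
    refine Filter.Tendsto.congr (fun A => (norm_star_apply_sub A B x).symm) ?_
    convert! this using 2
    change 0 = ‖x - (B : H →L[ℂ] H) (((star B : UnitaryOperators H) : H →L[ℂ] H) x)‖
    rw [← norm_star_apply_sub, sub_self, norm_zero]

/-- For a sequence `d`, records the values of a unitary operator and of its adjoint on `d`. -/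
noncomputable def unitaryValues (d : ℕ → H) (A : UnitaryOperators H) : (ℕ → H) × (ℕ → H) :=
  (fun n => (A : H →L[ℂ] H) (d n), fun n => ((star A : UnitaryOperators H) : H →L[ℂ] H) (d n))

theorem isEmbedding_unitaryValues {d : ℕ → H} (hd : DenseRange d) :
    Topology.IsEmbedding (unitaryValues d) := by
  have := isTopologicalGroup_unitary (H := H)
  refine ⟨⟨le_antisymm ?_ ?_⟩, fun A B hAB => ?_⟩
  · refine Continuous.le_induced (Continuous.prodMk
      (continuous_pi fun n => continuous_unitary_apply (d n))
      (continuous_pi fun n => (continuous_unitary_apply (d n)).comp continuous_inv))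
  · calc TopologicalSpace.induced (unitaryValues d) inferInstance
      _ ≤ TopologicalSpace.induced (unitaryValues d)
          (TopologicalSpace.induced Prod.fst Pi.topologicalSpace) :=
        induced_mono continuous_fst.le_induced
      _ = TopologicalSpace.induced
          (fun (A : UnitaryOperators H) n => (A : H →L[ℂ] H) (d n)) Pi.topologicalSpace :=
        induced_compose
      _ ≤ strongOperatorTopology H :=
        induced_eval_dense_le_induced_eval hd fun A => (Unitary.linearIsometryEquiv A).isometry
  · refine Subtype.ext (ContinuousLinearMap.ext fun x => ?_)
    refine hd.induction_on x (isClosed_eq (by fun_prop) (by fun_prop)) fun n => ?_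
    exact congrFun (congrArg Prod.fst hAB) n

/-- The pairs of sequences of values are cut out by closed conditions on inner products: both
sequences have the Gram matrix of `d`, and they are values of mutually adjoint maps. -/
theorem range_unitaryValues {d : ℕ → H} (hd : DenseRange d) :
    Set.range (unitaryValues d) = {p | ∀ m n, inner ℂ (p.1 m) (p.1 n) = inner ℂ (d m) (d n) ∧
      inner ℂ (p.2 m) (p.2 n) = inner ℂ (d m) (d n) ∧
      inner ℂ (p.1 m) (d n) = inner ℂ (d m) (p.2 n)} := by
  have hadj : ∀ A : UnitaryOperators H, ((star A : UnitaryOperators H) : H →L[ℂ] H) =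
      ContinuousLinearMap.adjoint (A : H →L[ℂ] H) := fun A => rfl
  refine Set.Subset.antisymm ?_ fun p hp => ?_
  · rintro _ ⟨A, rfl⟩ m n
    refine ⟨Unitary.inner_map_map A _ _, Unitary.inner_map_map (star A) _ _, ?_⟩
    simp only [unitaryValues, hadj, ContinuousLinearMap.adjoint_inner_right]
  · have hspan : Dense (Submodule.span ℂ (Set.range d) : Set H) :=
      Dense.mono Submodule.subset_span hd
    obtain ⟨L, hL⟩ := exists_linearIsometry_of_inner_eq hspan fun m n => ((hp m n).1).symm
    obtain ⟨M, hM⟩ := exists_linearIsometry_of_inner_eq hspan fun m n => ((hp m n).2.1).symm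
    have hLM : ∀ x y, inner ℂ (L x) y = inner ℂ x (M y) := by
      intro x y
      refine hd.induction_on₂ (p := fun x y => inner ℂ (L x) y = inner ℂ x (M y)) ?_ ?_ x y
      · exact isClosed_eq (by fun_prop) (by fun_prop)
      · intro m n
        rw [hL, hM, (hp m n).2.2]
    have hML : ∀ x, M (L x) = x := fun x => ext_inner_left ℂ fun v => by
      rw [← hLM, L.inner_map_map]
    have hLM' : ∀ x, L (M x) = x := fun x => ext_inner_right ℂ fun v => by
      rw [hLM, M.inner_map_map]
    let e : H ≃ₗᵢ[ℂ] H :=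
      ⟨LinearEquiv.ofLinearMap L.toLinearMap M.toLinearMap (LinearMap.ext hLM') (LinearMap.ext hML),
        L.norm_map⟩
    refine ⟨Unitary.linearIsometryEquiv.symm e, Prod.ext (funext hL) (funext fun n => ?_)⟩
    refine ext_inner_left ℂ fun v => ?_
    simp only [unitaryValues, hadj, ContinuousLinearMap.adjoint_inner_right]
    rw [← hM, ← hLM]
    rfl

theorem polishSpace_unitary [TopologicalSpace.SeparableSpace H] :
    PolishSpace (UnitaryOperators H) := by
  have hd := TopologicalSpace.denseRange_denseSeq H
  have : SecondCountableTopology H := UniformSpace.secondCountable_of_separable H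
  refine Topology.IsClosedEmbedding.polishSpace ⟨isEmbedding_unitaryValues hd, ?_⟩
  rw [range_unitaryValues hd]
  simp only [Set.ofPred_forall, Set.ofPred_and]
  refine isClosed_iInter fun m => isClosed_iInter fun n => ?_
  exact (isClosed_eq (by fun_prop) (by fun_prop)).inter
    ((isClosed_eq (by fun_prop) (by fun_prop)).inter (isClosed_eq (by fun_prop) (by fun_prop)))

/-- A neighbourhood of `1` contains the pointwise stabilizer of a finite set of vectors. -/
theorem exists_finset_stabilizer_subset {W : Set (UnitaryOperators H)} (hW : W ∈ 𝓝 1) :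
    ∃ s : Finset H, ∀ A : UnitaryOperators H, (∀ i : s, (A : H →L[ℂ] H) i = i) → A ∈ W := by
  rw [nhds_induced, Filter.mem_comap] at hW
  obtain ⟨t, ht, htW⟩ := hW
  rw [nhds_pi, Filter.mem_pi] at ht
  obtain ⟨s, hs, v, hv, hsub⟩ := ht
  refine ⟨hs.toFinset, fun A hA => htW (hsub fun x hx => ?_)⟩
  have hAx : (A : H →L[ℂ] H) x = x := hA ⟨x, hs.mem_toFinset.mpr hx⟩
  change (A : H →L[ℂ] H) x ∈ v x
  rw [hAx]
  exact mem_of_mem_nhds (hv x)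

end StrongOperatorTopology

/-! ### Bounded generation -/

theorem proposition4 {H : Type*} [NormedAddCommGroup H] [InnerProductSpace ℂ H]
    [CompleteSpace H] [TopologicalSpace.SeparableSpace H] (hdim : ¬ FiniteDimensional ℂ H)
    (F : Set (UnitaryOperators H)) (hsymm : ∀ A ∈ F, star A ∈ F)
    (hclosed : IsClosed[strongOperatorTopology H] F)
    (U : ℕ → UnitaryOperators H)
    (hgen : Subgroup.closure (F ∪ Set.range U) = ⊤) :
    ∃ n : ℕ, (adjoinUnitaries F U n) ^ n = Set.univ := by
  set E := adjoinUnitaries F U with hE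
  have hmono : Monotone E := by
    rintro m n hmn A (hA | hA | ⟨i, hi, hA⟩)
    exacts [Or.inl hA, Or.inr (Or.inl hA), Or.inr (Or.inr ⟨i, hi.trans hmn, hA⟩)]
  have hone : ∀ n, 1 ∈ E n := fun n => Or.inr (Or.inl rfl)
  have hstar : ∀ n, ∀ A ∈ E n, A⁻¹ ∈ E n := by
    rintro n A (hA | hA | ⟨i, hi, rfl | rfl⟩)
    · exact Or.inl (hsymm A hA)
    · rw [Set.mem_singleton_iff.mp hA, inv_one]
      exact hone n
    · exact Or.inr (Or.inr ⟨i, hi, Or.inr rfl⟩)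
    · exact Or.inr (Or.inr ⟨i, hi, Or.inl (star_star _)⟩)
  have hinv : ∀ n, (E n)⁻¹ = E n := fun n => Set.ext fun A =>
    ⟨fun hA => inv_inv A ▸ hstar n _ hA, fun hA => hstar n A hA⟩
  have hgenE : Subgroup.closure (⋃ n, E n) = ⊤ := by
    refine top_unique (hgen.symm.le.trans (Subgroup.closure_mono ?_))
    rintro A (hA | ⟨i, rfl⟩)
    exacts [Set.mem_iUnion.mpr ⟨0, Or.inl hA⟩,
      Set.mem_iUnion.mpr ⟨i, Or.inr (Or.inr ⟨i, le_rfl, Or.inl rfl⟩)⟩]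
  obtain ⟨n, s, hs⟩ : ∃ n, ∃ s : Finset H, ∀ A : UnitaryOperators H,
      (∀ i : s, (A : H →L[ℂ] H) i = i) → A ∈ E n ^ n := by
    let _ := strongOperatorTopology H
    have := isTopologicalGroup_unitary (H := H)
    have := polishSpace_unitary (H := H)
    have hclosedE : ∀ n, IsClosed (E n) := fun n => by
      refine hclosed.union (isClosed_singleton.union (Set.Finite.isClosed ?_))
      refine (((Set.finite_Iic n).image U).union
        ((Set.finite_Iic n).image fun i => star (U i))).subset ?_
      rintro A ⟨i, hi, rfl | rfl⟩
      exacts [Or.inl ⟨i, hi, rfl⟩, Or.inr ⟨i, hi, rfl⟩]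
    obtain ⟨n, hn⟩ := exists_pow_mem_nhds_one hmono hone hinv hclosedE hgenE
    exact ⟨n, exists_finset_stabilizer_subset hn⟩
  obtain ⟨z, hz, hz0⟩ := exists_inner_eq_orthogonal hdim (Subtype.val : s → H) s.finite_toSet
  obtain ⟨g, hg, -⟩ := exists_unitary_of_inner_eq fun i j => (hz i j).symm
  obtain ⟨m, hm⟩ := exists_mem_pow_of_closure_iUnion_eq_top hmono hone hinv hgenE g
  refine ⟨n + m + n + m + n, Set.eq_univ_of_forall fun u => ?_⟩
  have hu := exists_stabilizer_factorization hdim (Subtype.val : s → H) (g := g)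
    (fun i j => by rw [hg]; exact hz0 j i i.2) hs u
  have hm' : g⁻¹ ∈ E m ^ m := by
    rw [← hinv m, inv_pow]
    exact Set.inv_mem_inv.mpr hm
  have hsub : ∀ k ≤ n + m + n + m + n, E k ^ k ⊆ E (n + m + n + m + n) ^ k :=
    fun k hk => Set.pow_subset_pow_left (hmono hk)
  have hn := hsub n (by omega)
  rw [pow_add, pow_add, pow_add, pow_add]
  refine Set.mul_subset_mul (Set.mul_subset_mul (Set.mul_subset_mul (Set.mul_subset_mul hn ?_) hn)
    ?_) hn hu
  · exact Set.singleton_subset_iff.mpr (hsub m (by omega) hm)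
  · exact Set.singleton_subset_iff.mpr (hsub m (by omega) hm')
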